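/- Rings are associative with identity, not necessarily commutative. For a ring $R$, let $U(R)$ be its group of units and let $\Delta(R)=\{a\in R : 1-ua\in U(R)\text{ for all }u\in U(R)\}$. For an integer $n\ge 1$, the ring $R$ is called $n$-$\Delta$U if $u^n-1\in\Delta(R)$ for every $u\in U(R)$. The ring $R$ is called 2-primal if its prime radical (the intersection of all prime two-sided ideals of $R$) consists precisely of the nilpotent elements of $R$. For a ring endomorphism $\alpha$ of $R$, the ring $R$ is called $\alpha$-compatible if, for all $a,b\in R$, $ab=0$ if and only if $a\alpha(b)=0$. Let $R[x;\alpha]$ denote the skew polynomial ring, whose elements are the polynomials $\sum_i a_ix^i$ with $a_i\in R$, multiplied according to $xr=\alpha(r)x$ for $r\in R$. Theorem. Let $R$ be a 2-primal ring and let $\alpha$ be an endomorphism of $R$ such that $R$ is $\alpha$-compatible, and let $n\ge 1$. Then $R[x;\alpha]$ is $n$-$\Delta$U if and only if $R$ is $n$-$\Delta$U. -/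

import Mathlib

/-- `Δ(R)`: the elements `a` of `R` such that `1 - u a` is invertible for every invertible `u`. -/
def deltaSet (R : Type*) [Ring R] : Set R :=
  {a | ∀ u : R, IsUnit u → IsUnit (1 - u * a)}

/-- `R` is `n`-`ΔU`: `u ^ n - 1 ∈ Δ(R)` for every unit `u` of `R`. -/
def IsNDeltaU (n : ℕ) (R : Type*) [Ring R] : Prop :=
  ∀ u : R, IsUnit u → u ^ n - 1 ∈ deltaSet R

/-- A prime ideal of a (not necessarily commutative) ring: a proper two-sided ideal `P` such that
`a R b ⊆ P` implies `a ∈ P` or `b ∈ P`. -/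
def IsPrimeTwoSided {R : Type*} [Ring R] (P : TwoSidedIdeal R) : Prop :=
  P ≠ ⊤ ∧ ∀ a b : R, (∀ r : R, a * r * b ∈ P) → a ∈ P ∨ b ∈ P

/-- The prime radical (lower nil-radical): the intersection of all prime ideals. -/
def lowerNilradical (R : Type*) [Ring R] : TwoSidedIdeal R :=
  sInf {P : TwoSidedIdeal R | IsPrimeTwoSided P}

/-- `R` is 2-primal: the prime radical consists precisely of the nilpotent elements. -/
def IsTwoPrimal (R : Type*) [Ring R] : Prop :=
  ∀ a : R, a ∈ lowerNilradical R ↔ IsNilpotent a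

/-- `R` is `α`-compatible: `a b = 0 ↔ a α(b) = 0` for all `a`, `b`. -/
def IsCompatibleEnd {R : Type*} [Ring R] (α : R →+* R) : Prop :=
  ∀ a b : R, a * b = 0 ↔ a * α b = 0

/-- The action of the monoid `ℕ` on `R` by the iterates of `α`; this is the form in which
`SkewPolynomial` takes its endomorphism. -/
@[reducible] def iterateAction {R : Type*} [Ring R] (α : R →+* R) :
    MulSemiringAction (Multiplicative ℕ) R where
  smul k r := (α ^ (Multiplicative.toAdd k)) r
  one_smul _ := rfl
  mul_smul j k r := by
    change (α ^ (Multiplicative.toAdd j + Multiplicative.toAdd k)) r = _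
    rw [pow_add]
    rfl
  smul_zero k := map_zero (α ^ (Multiplicative.toAdd k))
  smul_add k := map_add (α ^ (Multiplicative.toAdd k))
  smul_one k := map_one (α ^ (Multiplicative.toAdd k))
  smul_mul k := map_mul (α ^ (Multiplicative.toAdd k))

/-- The skew polynomial ring `R[x; α]`: left polynomials `∑ aᵢ xⁱ` with `x r = α(r) x`. -/
def SkewPolyRing {R : Type*} [Ring R] (_α : R →+* R) : Type _ := SkewPolynomial R

noncomputable instance SkewPolyRing.instRing {R : Type*} [Ring R] (α : R →+* R) :
    Ring (SkewPolyRing α) :=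
  letI := iterateAction α
  inferInstanceAs (Ring (SkewPolynomial R))

/-- The variable `x` of `R[x; α]`. -/
noncomputable def SkewPolyRing.X {R : Type*} [Ring R] (α : R →+* R) : SkewPolyRing α :=
  (SkewPolynomial.X : SkewPolynomial R)

/-- The inclusion of the constants `R → R[x; α]`. -/
noncomputable def SkewPolyRing.C {R : Type*} [Ring R] (α : R →+* R) : R →+* SkewPolyRing α :=
  letI := iterateAction α
  (SkewPolynomial.CRingHom : R →+* SkewPolynomial R)

/-- The defining relation `x r = α(r) x`. -/
theorem SkewPolyRing.X_mul_C {R : Type*} [Ring R] (α : R →+* R) (r : R) :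
    SkewPolyRing.X α * SkewPolyRing.C α r = SkewPolyRing.C α (α r) * SkewPolyRing.X α := by
  let _ := iterateAction α
  have key : (SkewPolynomial.X : SkewPolynomial R) * SkewPolynomial.C r =
      SkewPolynomial.C (α r) * SkewPolynomial.X := by
    rw [SkewPolynomial.C_mul_X_eq_monomial, ← SkewPolynomial.monomial_zero_left,
      SkewPolynomial.X_mul_monomial]
    rfl
  exact key

/-!
Let `N` be the set of nilpotent elements of `R`; as `R` is 2-primal, `N` is the prime radical and in
particular a two-sided ideal. The theorem rests on a description of the units of `S = R[x; α]`:
`f = ∑ fᵢ xⁱ` is a unit exactly when `f₀` is a unit of `R` and `fᵢ ∈ N` for all `i ≥ 1`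
(`SkewPolyRing.isUnit_iff`).

* For necessity, let `f g = 1 = g f` and suppose that `fᵢ ∈ N` for all `i > m`, where `m ≥ 1`.
  Compatibility makes membership of a product in `N` insensitive to applying `α` to a factor
  (`IsCompatibleEnd.isNilpotent_mul_map_iff`), and `N` is completely semiprime, so multiplying the
  coefficient of `x ^ (m + j)` in `f g` by `f_m` gives `f_m g_j ∈ N` by descending induction on
  `j`. As `g₀` is a unit, `f_m ∈ N`.
* For sufficiency, polynomials with coefficients in `N` are nilpotent: the prime radical is locally
  nilpotent (`exists_pow_subset_zero_of_subset_lowerNilradical`), and compatibility allows the twists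
  in the coefficients of a power to be ignored. Such polynomials form an ideal, so adding one to a
  unit gives a unit.

The polynomials with `fᵢ ∈ N` for all `i ≥ 1` form a subring of `S`, and `f ↦ f₀` is a ring
homomorphism `S → R` split by the constants. Hence for units `f`, `g` of `S` the polynomial
`1 - g (f ^ n - 1)` is a unit if and only if its constant coefficient `1 - g₀ (f₀ ^ n - 1)` is.
-/

open scoped Pointwise

/-! ### Local nilpotence of the prime radical -/

/-- If `a R b ⊆ I`, then the product of the ideals `I + (a)` and `I + (b)` lies in `I`. -/
theorem TwoSidedIdeal.mul_mem_of_mem_sup_span {R : Type*} [Ring R] {I : TwoSidedIdeal R} {a b : R}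
    (hab : ∀ r : R, a * r * b ∈ I) {y z : R} (hy : y ∈ I ⊔ TwoSidedIdeal.span {a})
    (hz : z ∈ I ⊔ TwoSidedIdeal.span {b}) : y * z ∈ I := by
  -- The transporter `{z | a R z ⊆ I}` is an ideal containing `b`.
  let J : TwoSidedIdeal R := .mk' {z | ∀ r : R, a * r * z ∈ I}
    (fun r => by simp [I.zero_mem])
    (fun hx hy r => by simpa [mul_add] using I.add_mem (hx r) (hy r))
    (fun hx r => by simpa using I.neg_mem (hx r))
    (fun {x y} hy r => by simpa [mul_assoc] using hy (r * x))
    (fun {x y} hx r => by simpa [mul_assoc] using I.mul_mem_right _ y (hx r))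
  have hJ : I ⊔ TwoSidedIdeal.span {b} ≤ J := by
    refine sup_le (fun x hx => ?_) (TwoSidedIdeal.span_le.2 ?_)
    · exact (TwoSidedIdeal.mem_mk' ..).2 fun r => I.mul_mem_left _ _ hx
    · rintro x rfl
      exact (TwoSidedIdeal.mem_mk' ..).2 hab
  -- The elements `y` with `y R (I + (b)) ⊆ I` form an ideal containing `a`.
  let K : TwoSidedIdeal R := .mk'
    {y | ∀ r : R, ∀ z ∈ I ⊔ TwoSidedIdeal.span {b}, y * r * z ∈ I}
    (fun r z _ => by simp [I.zero_mem])
    (fun hx hy r z hz => by simpa [add_mul] using I.add_mem (hx r z hz) (hy r z hz))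
    (fun hx r z hz => by simpa using I.neg_mem (hx r z hz))
    (fun {x y} hy r z hz => by simpa [mul_assoc] using I.mul_mem_left x _ (hy r z hz))
    (fun {x y} hx r z hz => by simpa [mul_assoc] using hx (y * r) z hz)
  have hK : I ⊔ TwoSidedIdeal.span {a} ≤ K := by
    refine sup_le (fun x hx => ?_) (TwoSidedIdeal.span_le.2 ?_)
    · refine (TwoSidedIdeal.mem_mk' ..).2 fun r z _ => ?_
      rw [mul_assoc]
      exact I.mul_mem_right _ _ hx
    · rintro x rfl
      exact (TwoSidedIdeal.mem_mk' ..).2 fun r z hz => (TwoSidedIdeal.mem_mk' ..).1 (hJ hz) r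
  simpa using (TwoSidedIdeal.mem_mk' ..).1 (hK hy) 1 z hz

/-- A nonempty chain of two-sided ideals, none of which contains any of the finite sets `T i`, has
an upper bound with the same property, namely its union. -/
theorem TwoSidedIdeal.exists_chain_upper_bound {R ι : Type*} [Ring R] {T : ι → Set R}
    (hT : ∀ i, (T i).Finite) {c : Set (TwoSidedIdeal R)}
    (hc : IsChain (· ≤ ·) c) (hcT : ∀ I ∈ c, ∀ i, ¬ T i ⊆ I) {I₀ : TwoSidedIdeal R}
    (hI₀ : I₀ ∈ c) :
    ∃ U : TwoSidedIdeal R, (∀ i, ¬ T i ⊆ U) ∧ ∀ I ∈ c, I ≤ U := by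
  let U : TwoSidedIdeal R := .mk' {x | ∃ I ∈ c, x ∈ I}
    ⟨I₀, hI₀, I₀.zero_mem⟩
    (by
      rintro x y ⟨I, hI, hx⟩ ⟨J, hJ, hy⟩
      rcases hc.total hI hJ with h | h
      · exact ⟨J, hJ, J.add_mem (h hx) hy⟩
      · exact ⟨I, hI, I.add_mem hx (h hy)⟩)
    (fun ⟨I, hI, hx⟩ => ⟨I, hI, I.neg_mem hx⟩)
    (fun ⟨I, hI, hx⟩ => ⟨I, hI, I.mul_mem_left _ _ hx⟩)
    (fun ⟨I, hI, hx⟩ => ⟨I, hI, I.mul_mem_right _ _ hx⟩)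
  have hU : ∀ x, x ∈ U ↔ ∃ I ∈ c, x ∈ I := fun x => TwoSidedIdeal.mem_mk' ..
  refine ⟨U, fun i hi => ?_, fun I hI x hx => (hU x).2 ⟨I, hI, hx⟩⟩
  obtain ⟨I, hI, hTI⟩ := DirectedOn.exists_mem_subset_of_finite_of_subset_sUnion
    (c := (fun I : TwoSidedIdeal R => (I : Set R)) '' c) ⟨_, I₀, hI₀, rfl⟩
    (by
      rintro _ ⟨I, hI, rfl⟩ _ ⟨J, hJ, rfl⟩
      rcases hc.total hI hJ with h | h
      · exact ⟨_, ⟨J, hJ, rfl⟩, h, le_rfl⟩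
      · exact ⟨_, ⟨I, hI, rfl⟩, le_rfl, h⟩)
    (hT i) (fun x hx => by
      obtain ⟨I, hI, hxI⟩ := (hU x).1 (hi hx)
      exact ⟨_, ⟨I, hI, rfl⟩, hxI⟩)
  obtain ⟨I, hI, rfl⟩ := hI
  exact hcT I hI i hTI

/-- The prime radical is locally nilpotent: all sufficiently long products of elements of a finite
subset vanish. Otherwise an ideal that is maximal among those containing no power of the subset
would be a prime ideal not containing the subset. -/
theorem exists_pow_subset_zero_of_subset_lowerNilradical {R : Type*} [Ring R] {F : Set R}
    (hF : F.Finite) (hFN : F ⊆ lowerNilradical R) : ∃ L : ℕ, F ^ L ⊆ {0} := by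
  by_contra! hcon
  have hfin : ∀ L : ℕ, (F ^ L).Finite := by
    intro L
    induction L with
    | zero => simp
    | succ L ih =>
      rw [pow_succ]
      exact ih.mul hF
  obtain ⟨M, -, hM⟩ := zorn_le_nonempty₀ {I : TwoSidedIdeal R | ∀ L : ℕ, ¬ F ^ L ⊆ I}
    (fun c hcs hc I hI => TwoSidedIdeal.exists_chain_upper_bound hfin hc
      (fun J hJ => hcs hJ) hI) ⊥
    (fun L hL => hcon L fun x hx => (TwoSidedIdeal.mem_bot R).1 (hL hx))
  have hlarger : ∀ a ∉ M, ∃ L : ℕ, F ^ L ⊆ (M ⊔ TwoSidedIdeal.span {a} : TwoSidedIdeal R) := by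
    intro a ha
    by_contra! h
    exact ha (hM.2 h le_sup_left
      (TwoSidedIdeal.mem_sup_right (TwoSidedIdeal.subset_span (Set.mem_singleton a))))
  have hprime : IsPrimeTwoSided M := by
    refine ⟨?_, fun a b hab => ?_⟩
    · rintro rfl
      exact hM.1 0 fun x _ => trivial
    · by_contra! h
      obtain ⟨k, hk⟩ := hlarger a h.1
      obtain ⟨l, hl⟩ := hlarger b h.2
      refine hM.1 (k + l) ?_
      rw [pow_add]
      rintro _ ⟨y, hy, z, hz, rfl⟩
      exact TwoSidedIdeal.mul_mem_of_mem_sup_span hab (hk hy) (hl hz)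
  refine hM.1 1 ?_
  rw [pow_one]
  exact fun x hx => (TwoSidedIdeal.mem_sInf R).1 (hFN hx) M hprime

/-! ### Nilpotent products and compatible endomorphisms -/

theorem IsNilpotent.mul_swap {R : Type*} [Ring R] {a b : R} (h : IsNilpotent (a * b)) :
    IsNilpotent (b * a) := by
  obtain ⟨k, hk⟩ := h
  refine ⟨k + 1, ?_⟩
  have : (b * a) ^ (k + 1) = b * (a * b) ^ k * a := by
    rw [_root_.pow_succ, ← mul_assoc, mul_pow_mul b a k, mul_assoc, mul_pow_mul a b k, ← mul_assoc]
  rw [this, hk, mul_zero, zero_mul]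

theorem IsCompatibleEnd.pow {R : Type*} [Ring R] {α : R →+* R} (hα : IsCompatibleEnd α) (i : ℕ) :
    IsCompatibleEnd (α ^ i) := by
  induction i with
  | zero => exact fun a b => Iff.rfl
  | succ i ih =>
    intro a b
    rw [pow_succ']
    exact (ih a b).trans (hα a _)

/-- Under a compatible endomorphism, a twist in the middle of a product does not affect whether the
product vanishes. -/
theorem IsCompatibleEnd.mul_map_mul_eq_zero_iff {R : Type*} [Ring R] {α : R →+* R}
    (hα : IsCompatibleEnd α) (a b c : R) : a * α b * c = 0 ↔ a * b * c = 0 := by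
  rw [hα (a * α b) c, mul_assoc, ← map_mul, ← hα a, mul_assoc]

theorem IsCompatibleEnd.isNilpotent_mul_map_iff {R : Type*} [Ring R] {α : R →+* R}
    (hα : IsCompatibleEnd α) (a b : R) : IsNilpotent (a * α b) ↔ IsNilpotent (a * b) := by
  have key : ∀ (k : ℕ) (c : R), c * (a * α b) ^ k = 0 ↔ c * (a * b) ^ k = 0 := by
    intro k
    induction k with
    | zero => simp
    | succ k ih =>
      intro c
      rw [pow_succ', ← mul_assoc, ih, ← mul_assoc, hα.mul_map_mul_eq_zero_iff, pow_succ',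
        mul_assoc c a b, mul_assoc]
  exact exists_congr fun k => by simpa using key k 1

theorem IsTwoPrimal.mul_mul_mem {R : Type*} [Ring R] (hR : IsTwoPrimal R) {a b : R}
    (h : a * b ∈ lowerNilradical R) (r : R) : a * r * b ∈ lowerNilradical R := by
  have hba : b * a ∈ lowerNilradical R := (hR _).2 ((hR _).1 h).mul_swap
  have hbar := TwoSidedIdeal.mul_mem_right _ _ r hba
  rw [mul_assoc] at hbar
  exact (hR _).2 ((hR _).1 hbar).mul_swap

theorem IsTwoPrimal.mul_pow_map_mem_iff {R : Type*} [Ring R] (hR : IsTwoPrimal R) {α : R →+* R}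
    (hα : IsCompatibleEnd α) (i : ℕ) (a b : R) :
    a * (α ^ i) b ∈ lowerNilradical R ↔ a * b ∈ lowerNilradical R := by
  rw [hR, hR, (hα.pow i).isNilpotent_mul_map_iff]

/-- The ideal of nilpotent elements of a 2-primal ring is completely semiprime, in a form adapted to
products. -/
theorem IsTwoPrimal.mul_mem_of_mul_mul_mem {R : Type*} [Ring R] (hR : IsTwoPrimal R) {a b : R}
    (h : a * (a * b) ∈ lowerNilradical R) : a * b ∈ lowerNilradical R := by
  have h2 : (a * b) * (a * b) ∈ lowerNilradical R := by
    have := hR.mul_mul_mem h b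
    rwa [mul_assoc] at this ⊢
  obtain ⟨k, hk⟩ := (hR _).1 h2
  exact (hR _).2 ⟨2 * k, by rw [pow_mul, sq, hk]⟩

/-! ### Coefficients of skew polynomials -/

namespace SkewPolyRing

variable {R : Type*} [Ring R] {α : R →+* R}

/-- The coefficient of `xⁱ` in a skew polynomial, with coefficients written on the left. -/
noncomputable def coeff (f : SkewPolyRing α) (i : ℕ) : R :=
  SkewPolynomial.coeff f i

theorem ext_coeff {f g : SkewPolyRing α} (h : ∀ i, coeff f i = coeff g i) : f = g :=
  SkewPolynomial.ext h

theorem coeff_zero (i : ℕ) : coeff (0 : SkewPolyRing α) i = 0 := rfl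

theorem coeff_add (f g : SkewPolyRing α) (i : ℕ) : coeff (f + g) i = coeff f i + coeff g i :=
  SkewPolynomial.coeff_add f g i

theorem coeff_sub (f g : SkewPolyRing α) (i : ℕ) : coeff (f - g) i = coeff f i - coeff g i := by
  rw [eq_sub_iff_add_eq, ← coeff_add, sub_add_cancel]

theorem coeff_C (a : R) (i : ℕ) : coeff (C α a) i = if i = 0 then a else 0 :=
  SkewPolynomial.coeff_C

theorem coeff_one (i : ℕ) : coeff (1 : SkewPolyRing α) i = if i = 0 then 1 else 0 := by
  rw [← map_one (C α), coeff_C]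

theorem exists_coeff_eq_zero (f : SkewPolyRing α) : ∃ m : ℕ, ∀ i, m ≤ i → coeff f i = 0 := by
  obtain ⟨m, hm⟩ := (SkewPolynomial.support f).bddAbove
  refine ⟨m + 1, fun i hi => ?_⟩
  by_contra h
  have := hm (SkewPolynomial.mem_support_iff.2 h)
  omega

theorem coeff_mul (f g : SkewPolyRing α) (k : ℕ) :
    coeff (f * g) k =
      ∑ ij ∈ Finset.HasAntidiagonal.antidiagonal k, coeff f ij.1 * (α ^ ij.1) (coeff g ij.2) := by
  let _ := iterateAction α
  exact (SkewMonoidAlgebra.coeff_mul_antidiagonal_of_finset (k := R) (G := Multiplicative ℕ) f g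
    (Multiplicative.ofAdd k) (Finset.HasAntidiagonal.antidiagonal k : Finset (ℕ × ℕ))
    (fun {p} => Finset.HasAntidiagonal.mem_antidiagonal (A := ℕ) (n := k) (a := p)))

/-- The constant coefficient as a ring homomorphism `R[x; α] → R`, that is, the quotient by the
two-sided ideal generated by `x`. -/
noncomputable def constantCoeff : SkewPolyRing α →+* R where
  toFun f := coeff f 0
  map_zero' := rfl
  map_one' := by simp [coeff_one]
  map_add' f g := coeff_add f g 0
  map_mul' f g := by
    rw [coeff_mul, Finset.Nat.antidiagonal_zero, Finset.sum_singleton]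
    rfl

theorem constantCoeff_apply (f : SkewPolyRing α) : constantCoeff f = coeff f 0 := rfl

theorem constantCoeff_C (a : R) : constantCoeff (C α a) = a := by
  simp [constantCoeff_apply, coeff_C]

/-! ### Polynomials with nilpotent coefficients -/

theorem map_pow_mem_lowerNilradical (hR : IsTwoPrimal R) (i : ℕ) {a : R}
    (ha : a ∈ lowerNilradical R) : (α ^ i) a ∈ lowerNilradical R :=
  (hR _).2 (((hR _).1 ha).map (α ^ i))

theorem coeff_mul_mem_lowerNilradical (f : SkewPolyRing α) {h : SkewPolyRing α}
    (hR : IsTwoPrimal R) (hh : ∀ i, coeff h i ∈ lowerNilradical R) (k : ℕ) :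
    coeff (f * h) k ∈ lowerNilradical R := by
  rw [coeff_mul]
  exact sum_mem fun ij _ =>
    TwoSidedIdeal.mul_mem_left _ _ _ (map_pow_mem_lowerNilradical hR _ (hh _))

/-- If all untwisted products `c * h_{i₁} * ⋯ * h_{i_L}` of coefficients of `h` vanish, then so do
the multiples by `c` of the coefficients of `h ^ L`. -/
theorem mul_coeff_pow_eq_zero (hα : IsCompatibleEnd α) (h : SkewPolyRing α) (L : ℕ) (c : R)
    (hc : ∀ w ∈ Set.range (coeff h) ^ L, c * w = 0) (k : ℕ) : c * coeff (h ^ L) k = 0 := by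
  induction L generalizing c k with
  | zero =>
    have : c = 0 := by simpa using hc 1 (by simp)
    rw [this, zero_mul]
  | succ L ih =>
    rw [pow_succ', coeff_mul, Finset.mul_sum]
    refine Finset.sum_eq_zero fun ij _ => ?_
    -- Compatibility removes the twist on the coefficient of `h ^ L`.
    rw [← mul_assoc, ← hα.pow]
    refine ih _ (fun w hw => ?_) _
    rw [mul_assoc]
    refine hc _ ?_
    rw [pow_succ']
    exact Set.mul_mem_mul ⟨_, rfl⟩ hw

theorem isNilpotent_of_coeff_mem (hα : IsCompatibleEnd α) {h : SkewPolyRing α}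
    (hh : ∀ i, coeff h i ∈ lowerNilradical R) : IsNilpotent h := by
  have hfin : (Set.range (coeff h)).Finite := by
    obtain ⟨m, hm⟩ := exists_coeff_eq_zero h
    refine (((Set.finite_lt_nat m).image (coeff h)).union (Set.finite_singleton 0)).subset ?_
    rintro _ ⟨i, rfl⟩
    rcases lt_or_ge i m with hi | hi
    · exact Or.inl ⟨i, hi, rfl⟩
    · exact Or.inr (hm i hi)
  obtain ⟨L, hL⟩ := exists_pow_subset_zero_of_subset_lowerNilradical hfin
    (by rintro _ ⟨i, rfl⟩; exact hh i)
  refine ⟨L, ext_coeff fun k => ?_⟩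
  have := mul_coeff_pow_eq_zero hα h L 1 (fun w hw => by rw [hL hw, mul_zero]) k
  rwa [one_mul] at this

/-- The skew polynomials whose coefficients in positive degree are nilpotent, as a subring. -/
def nilpotentTail (hR : IsTwoPrimal R) (α : R →+* R) : Subring (SkewPolyRing α) where
  carrier := {f | ∀ i ≠ 0, coeff f i ∈ lowerNilradical R}
  zero_mem' i _ := TwoSidedIdeal.zero_mem _
  one_mem' i hi := by
    rw [coeff_one, if_neg hi]
    exact TwoSidedIdeal.zero_mem _
  add_mem' hf hg i hi := by
    rw [coeff_add]
    exact TwoSidedIdeal.add_mem _ (hf i hi) (hg i hi)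
  neg_mem' {f} hf i hi := by
    rw [← zero_sub, coeff_sub]
    exact TwoSidedIdeal.sub_mem _ (TwoSidedIdeal.zero_mem _) (hf i hi)
  mul_mem' {f g} hf hg k hk := by
    rw [coeff_mul]
    refine sum_mem fun ij hij => ?_
    rw [Finset.HasAntidiagonal.mem_antidiagonal] at hij
    by_cases hi : ij.1 = 0
    · exact TwoSidedIdeal.mul_mem_left _ _ _
        (map_pow_mem_lowerNilradical hR _ (hg _ (by omega)))
    · exact TwoSidedIdeal.mul_mem_right _ _ _ (hf _ hi)

/-! ### Units of the skew polynomial ring -/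

/-- Let `f g = 1` and let the coefficients of `f` above degree `m ≥ 1` be nilpotent. The coefficient
of `x ^ (m + j)` in `f g` is zero; after left multiplication by `f_m`, all its terms other than
`f_m f_m α ^ m (g_j)` are nilpotent once `f_m g_l` is for all `l > j`. Hence `f_m g_j` is nilpotent
for every `j`. -/
theorem coeff_mul_coeff_mem_of_mul_eq_one (hR : IsTwoPrimal R) (hα : IsCompatibleEnd α)
    {f g : SkewPolyRing α} (hfg : f * g = 1) {m : ℕ} (hm : m ≠ 0)
    (hf : ∀ i, m < i → coeff f i ∈ lowerNilradical R) (j : ℕ) :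
    coeff f m * coeff g j ∈ lowerNilradical R := by
  obtain ⟨K, hK⟩ := exists_coeff_eq_zero g
  suffices ∀ d j, K ≤ j + d → coeff f m * coeff g j ∈ lowerNilradical R from
    this K j (by omega)
  intro d
  induction d with
  | zero =>
    intro j hj
    rw [hK j hj, mul_zero]
    exact TwoSidedIdeal.zero_mem _
  | succ d ih =>
    intro j hj
    apply hR.mul_mem_of_mul_mul_mem
    rw [← mul_assoc, ← hR.mul_pow_map_mem_iff hα m, mul_assoc]
    have hmem : (m, j) ∈ Finset.HasAntidiagonal.antidiagonal (m + j) :=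
      Finset.HasAntidiagonal.mem_antidiagonal.2 rfl
    have hsum : coeff f m * coeff (f * g) (m + j) = 0 := by
      rw [hfg, coeff_one, if_neg (by omega), mul_zero]
    rw [coeff_mul, Finset.mul_sum, ← Finset.add_sum_erase _ _ hmem] at hsum
    rw [eq_neg_of_add_eq_zero_left hsum]
    refine TwoSidedIdeal.neg_mem _ (sum_mem fun ij hij => ?_)
    obtain ⟨hne, hij⟩ := Finset.mem_erase.1 hij
    rw [Finset.HasAntidiagonal.mem_antidiagonal] at hij
    rcases lt_trichotomy ij.1 m with hi | hi | hi
    · rw [← mul_assoc, hR.mul_pow_map_mem_iff hα]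
      exact hR.mul_mul_mem (ih _ (by omega)) _
    · exact absurd (Prod.ext hi (by simpa [hi] using hij)) hne
    · exact TwoSidedIdeal.mul_mem_left _ _ _ (TwoSidedIdeal.mul_mem_right _ _ _ (hf _ hi))

theorem coeff_mem_of_isUnit (hR : IsTwoPrimal R) (hα : IsCompatibleEnd α) {f : SkewPolyRing α}
    (hf : IsUnit f) {i : ℕ} (hi : i ≠ 0) : coeff f i ∈ lowerNilradical R := by
  obtain ⟨g, hfg, hgf⟩ := isUnit_iff_exists.1 hf
  obtain ⟨M, hM⟩ := exists_coeff_eq_zero f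
  suffices ∀ d i, i ≠ 0 → M ≤ i + d → coeff f i ∈ lowerNilradical R from
    this M i hi (by omega)
  intro d
  induction d with
  | zero =>
    intro i _ hMi
    rw [hM i hMi]
    exact TwoSidedIdeal.zero_mem _
  | succ d ih =>
    intro i hi hMi
    have hmem := coeff_mul_coeff_mem_of_mul_eq_one hR hα hfg hi
      (fun l hl => ih l (by omega) (by omega)) 0
    have hunit : coeff g 0 * coeff f 0 = 1 := by
      rw [← constantCoeff_apply, ← constantCoeff_apply, ← map_mul, hgf, map_one]
    have := TwoSidedIdeal.mul_mem_right _ _ (coeff f 0) hmem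
    rwa [mul_assoc, hunit, mul_one] at this

/-- A skew polynomial over a 2-primal ring with compatible endomorphism is a unit if and only if its
constant coefficient is a unit and its other coefficients are nilpotent. -/
theorem isUnit_iff (hR : IsTwoPrimal R) (hα : IsCompatibleEnd α) {f : SkewPolyRing α} :
    IsUnit f ↔ IsUnit (constantCoeff f) ∧ f ∈ nilpotentTail hR α := by
  refine ⟨fun hf => ⟨hf.map constantCoeff, fun i hi => coeff_mem_of_isUnit hR hα hf hi⟩, ?_⟩
  rintro ⟨⟨u, hu⟩, hf⟩
  have htail : ∀ i, coeff (f - C α u) i ∈ lowerNilradical R := by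
    intro i
    rw [coeff_sub, coeff_C]
    split_ifs with hi
    · rw [hu, hi, constantCoeff_apply, sub_self]
      exact TwoSidedIdeal.zero_mem _
    · rw [sub_zero]
      exact hf i hi
  have hone : IsUnit (1 + C α ↑u⁻¹ * (f - C α u)) :=
    (isNilpotent_of_coeff_mem hα (coeff_mul_mem_lowerNilradical _ hR htail)).isUnit_one_add
  have hfactor : f = C α u * (1 + C α ↑u⁻¹ * (f - C α u)) := by
    rw [mul_add, ← mul_assoc, ← map_mul, u.mul_inv, map_one, one_mul, mul_one, add_sub_cancel]
  rw [hfactor]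
  exact (u.isUnit.map (C α)).mul hone

end SkewPolyRing

theorem mainTheorem5 {R : Type*} [Ring R] (α : R →+* R) (n : ℕ) (hn : 1 ≤ n)
    (hR : IsTwoPrimal R) (hα : IsCompatibleEnd α) :
    IsNDeltaU n (SkewPolyRing α) ↔ IsNDeltaU n R := by
  constructor
  · intro h u hu v hv
    have := (h _ (hu.map (SkewPolyRing.C α)) _ (hv.map (SkewPolyRing.C α))).map
      (SkewPolyRing.constantCoeff (α := α))
    simpa [SkewPolyRing.constantCoeff_C] using this
  · intro h f hf g hg
    obtain ⟨hf₀, hft⟩ := (SkewPolyRing.isUnit_iff hR hα).1 hf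
    obtain ⟨hg₀, hgt⟩ := (SkewPolyRing.isUnit_iff hR hα).1 hg
    refine (SkewPolyRing.isUnit_iff hR hα).2 ⟨?_, ?_⟩
    · simpa using h _ hf₀ _ hg₀
    · exact sub_mem (one_mem _) (mul_mem hgt (sub_mem (pow_mem hft n) (one_mem _)))
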